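/- For each $n$ let $p=p(n)\in[0,1]$ and let $G(n,p)$ be the Erdős–Rényi random graph on $n$ nodes, in which each possible edge between two distinct nodes is present independently with probability $p$. Suppose that $\limsup_{n\to\infty}\frac{\ln n}{np}<1$ (where $\frac{\ln n}{np}=\infty$ if $p=0$ and $n\ge 2$). Let $k=k(n)$ be positive integers with $k=o(\sqrt{np})$ and, independently of the graph, let $S$ be chosen uniformly at random among the sets of nodes with $|S|=k$. Let $\lambda$ be the smallest eigenvalue of the grounded Laplacian $L_g(S)$, that is, of the matrix obtained from the graph Laplacian $L=D-A$ ($A$ the adjacency matrix, $D$ the diagonal matrix of degrees) by deleting the rows and columns indexed by $S$. Then $$(1-o(1))\,|S|\,p\;\le\;\lambda\;\le\;(1+o(1))\,|S|\,p$$ asymptotically almost surely; that is, there is a deterministic function $h(n)\to 0$ such that, over the random choice of the graph and of $S$, $\Pr\big[(1-h(n))|S|p\le\lambda\le(1+h(n))|S|p\big]\to 1$ as $n\to\infty$. -/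

import Mathlib

open Filter Topology MeasureTheory ProbabilityTheory

noncomputable section

open Classical in
/-- The grounded Laplacian `L_g(S)`: the Laplacian matrix `L = D - A` of `G` with the rows and
columns of the grounded nodes `S` removed. -/
def groundedLaplacian {V : Type*} [Fintype V] [DecidableEq V] (G : SimpleGraph V)
    (S : Finset V) : Matrix {v // v ∉ S} {v // v ∉ S} ℝ :=
  (G.lapMatrix ℝ).submatrix Subtype.val Subtype.val

/-- The smallest eigenvalue `λ(L_g(S))` of the grounded Laplacian. It is a genuine minimum as soon
as some node is not grounded, see `isLeast_groundedEigenvalue`. -/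
def groundedEigenvalue {V : Type*} [Fintype V] [DecidableEq V] (G : SimpleGraph V)
    (S : Finset V) : ℝ :=
  sInf {μ : ℝ | Module.End.HasEigenvalue (Matrix.toLin' (groundedLaplacian G S)) μ}

theorem isHermitian_groundedLaplacian {V : Type*} [Fintype V] [DecidableEq V]
    (G : SimpleGraph V) (S : Finset V) : (groundedLaplacian G S).IsHermitian := by
  classical
  exact (G.isHermitian_lapMatrix ℝ).submatrix _

theorem isLeast_groundedEigenvalue {V : Type*} [Fintype V] [DecidableEq V]
    (G : SimpleGraph V) (S : Finset V) (hS : ∃ v, v ∉ S) :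
    IsLeast {μ : ℝ | Module.End.HasEigenvalue (Matrix.toLin' (groundedLaplacian G S)) μ}
      (groundedEigenvalue G S) := by
  have hset : {μ : ℝ | Module.End.HasEigenvalue (Matrix.toLin' (groundedLaplacian G S)) μ} =
      Set.range (isHermitian_groundedLaplacian G S).eigenvalues := by
    rw [← Matrix.IsHermitian.spectrum_real_eq_range_eigenvalues]
    ext μ
    rw [Set.mem_ofPred_eq, Module.End.hasEigenvalue_iff_mem_spectrum, Matrix.spectrum_toLin']
  have hne : Nonempty {v // v ∉ S} := let ⟨v, hv⟩ := hS; ⟨⟨v, hv⟩⟩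
  have hfin : {μ : ℝ | Module.End.HasEigenvalue
      (Matrix.toLin' (groundedLaplacian G S)) μ}.Finite := by
    rw [hset]; exact Set.finite_range _
  have hn : {μ : ℝ | Module.End.HasEigenvalue
      (Matrix.toLin' (groundedLaplacian G S)) μ}.Nonempty := by
    rw [hset]; exact Set.range_nonempty _
  exact ⟨hn.csInf_mem hfin, fun μ hμ => csInf_le hfin.bddBelow hμ⟩

/-- The joint law of an Erdős–Rényi random graph `G(n, p)` on the nodes `Fin n` (every edge present
independently with probability `p`) and, independently of it, a grounded set chosen uniformly at
random among the `k`-element sets of nodes. -/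
def groundedErdosRenyi (n : ℕ) (p : unitInterval) (k : ℕ) :
    Measure (SimpleGraph (Fin n) × Finset (Fin n)) :=
  (SimpleGraph.binomialRandom (Fin n) p).prod (uniformOn {S : Finset (Fin n) | S.card = k})

end

/-! Write L = np and k = |S|. The all-ones vector in the Rayleigh quotient gives λ|Sᶜ| ≤ e(S, Sᶜ),
and e(S, Sᶜ) concentrates around k|Sᶜ|p: this is the upper bound.

For the lower bound split x = a·1 + y with ∑ y = 0. The quadratic form is the Dirichlet energy on Sᶜ
plus ∑ d_v x_v², where d_v counts the neighbours of v in S. If the energy is at least m∑y²,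
completing squares with d_v ≤ k spends half of it and keeps a²e(S, Sᶜ)(1 − 2k/m)
(`le_groundedEigenvalue_of_expansion`). Hence λ ≥ (1 − δ − 2k/m)kp, with δ the relative fluctuation
of e(S, Sᶜ).

The gap m comes from `cheeger_inequality`: edge expansion cL and degrees at most 4L outside S give m
= c²L/32. Only its order in L matters, since k = o(√L) and L → ∞ force k/m → 0. Expansion is where
the limsup hypothesis is decisive: ln n ≤ (1 − τ)L eventually, while a small set A fails with
probability at most exp(−(1 − τ/2)L|A|), so the union bound over all A still tends to zero.

All failure bounds are uniform over fixed S with |S| = k, so Fubini passes them to the random S. -/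

open Filter Topology MeasureTheory ProbabilityTheory

noncomputable section

/-! ### Cheeger's inequality for weighted graphs. -/

section Cheeger

variable {ι : Type*} [Fintype ι]

/-- The `ℓ¹` isoperimetric inequality: edge expansion of small sets bounds the total positive
variation of a nonnegative function with small support. -/
theorem mul_sum_le_sum_posPart_sub [DecidableEq ι] (w : ι → ι → ℝ) (β : ℝ)
    (hexp : ∀ A : Finset ι, 2 * A.card ≤ Fintype.card ι →
      β * A.card ≤ ∑ u ∈ A, ∑ v ∈ Aᶜ, w u v)
    (f : ι → ℝ) (hf : ∀ i, 0 ≤ f i)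
    (hsupp : 2 * (Finset.univ.filter fun i => 0 < f i).card ≤ Fintype.card ι) :
    β * ∑ i, f i ≤ ∑ u, ∑ v, w u v * max (f u - f v) 0 := by
  induction hn : (Finset.univ.filter fun i => 0 < f i).card using Nat.strong_induction_on
    generalizing f with
  | _ n ih =>
  subst hn
  set A := Finset.univ.filter fun i => 0 < f i with hA
  have hout : ∀ i, i ∉ A → f i = 0 := fun i hi => by
    have : ¬ 0 < f i := by simpa [hA] using hi
    exact le_antisymm (not_lt.1 this) (hf i)
  rcases A.eq_empty_or_nonempty with h0 | hne
  · have hz : ∀ i, f i = 0 := fun i => hout i (by simp [h0])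
    simp [hz]
  obtain ⟨a, haA, hmin⟩ := A.exists_min_image f hne
  have ht : 0 < f a := by simpa [hA] using haA
  -- Layer-cake step: remove the lowest layer, of height `f a` over the support `A`. It contributes
  -- exactly `f a` times the boundary weight of `A` to the variation, and the support shrinks.
  set g : ι → ℝ := fun i => f i - if i ∈ A then f a else 0 with hg
  have hg0 : ∀ i, 0 ≤ g i := fun i => by
    by_cases hi : i ∈ A
    · simpa [hg, hi] using hmin i hi
    · simpa [hg, hi] using hf i
  have hsub : (Finset.univ.filter fun i => 0 < g i) ⊂ A := by
    rw [Finset.ssubset_iff_of_subset]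
    · exact ⟨a, haA, by simp [hg, haA]⟩
    · intro i hi
      by_contra hiA
      have := (Finset.mem_filter.1 hi).2
      simp [hg, hiA, hout i hiA] at this
  have hcard := Finset.card_lt_card hsub
  have key := ih _ hcard g hg0 (by omega) rfl
  have hsum : ∑ i, f i = ∑ i, g i + f a * A.card := by
    simp only [hg, Finset.sum_sub_distrib, Finset.sum_ite_mem, Finset.univ_inter,
      Finset.sum_const, nsmul_eq_mul]
    ring
  have hvar : ∑ u, ∑ v, w u v * max (f u - f v) 0 =
      ∑ u, ∑ v, w u v * max (g u - g v) 0 + f a * ∑ u ∈ A, ∑ v ∈ Aᶜ, w u v := by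
    have : ∑ u ∈ A, ∑ v ∈ Aᶜ, w u v =
        ∑ u, ∑ v, if u ∈ A then (if v ∈ Aᶜ then w u v else 0) else 0 := by
      rw [← Finset.univ_inter A, ← Finset.sum_ite_mem]
      refine Finset.sum_congr rfl fun u _ => ?_
      by_cases hu : u ∈ A <;> simp [hu, Finset.sum_ite, Finset.filter_not, Finset.compl_eq_univ_sdiff]
    rw [this, Finset.mul_sum, ← Finset.sum_add_distrib]
    refine Finset.sum_congr rfl fun u _ => ?_
    rw [Finset.mul_sum, ← Finset.sum_add_distrib]
    refine Finset.sum_congr rfl fun v _ => ?_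
    by_cases hu : u ∈ A <;> by_cases hv : v ∈ A
    · simp [hg, hu, hv]
    · have h1 := hmin u hu
      have h2 : 0 ≤ f u := hf u
      simp only [hg, hu, hv, hout v hv, Finset.mem_compl, not_false_eq_true, if_true, if_false,
        sub_zero]
      rw [max_eq_left h2, max_eq_left (by linarith)]
      ring
    · have h2 : 0 ≤ f v := hf v
      have h1 := hmin v hv
      simp only [hg, hu, hv, hout u hu, if_true, if_false, sub_zero]
      rw [max_eq_right (by linarith), max_eq_right (by linarith)]
      ring
    · simp [hg, hu, hv]
  have hb := mul_le_mul_of_nonneg_left (hexp A hsupp) ht.le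
  rw [hsum, hvar]
  linarith

/-- A Cheeger inequality for nonnegative functions with small support. -/
theorem sum_sq_le_of_small_support [DecidableEq ι] (w : ι → ι → ℝ) (hw : ∀ u v, 0 ≤ w u v)
    (hsymm : ∀ u v, w u v = w v u) (β D : ℝ) (hβ : 0 ≤ β) (hD : 0 < D)
    (hdeg : ∀ u, ∑ v, w u v ≤ D)
    (hexp : ∀ A : Finset ι, 2 * A.card ≤ Fintype.card ι →
      β * A.card ≤ ∑ u ∈ A, ∑ v ∈ Aᶜ, w u v)
    (f : ι → ℝ) (hf : ∀ i, 0 ≤ f i)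
    (hsupp : 2 * (Finset.univ.filter fun i => 0 < f i).card ≤ Fintype.card ι) :
    β ^ 2 / (4 * D) * ∑ i, f i ^ 2 ≤ ∑ u, ∑ v, w u v * (f u - f v) ^ 2 := by
  have h1 := mul_sum_le_sum_posPart_sub w β hexp (fun i => f i ^ 2) (fun i => sq_nonneg _) (by
    have : (Finset.univ.filter fun i => 0 < f i ^ 2) = Finset.univ.filter fun i => 0 < f i := by
      refine Finset.filter_congr fun i _ => ?_
      rw [sq_pos_iff]
      exact ⟨fun h => lt_of_le_of_ne (hf i) h.symm, fun h => h.ne'⟩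
    rwa [this])
  set F := ∑ i, f i ^ 2 with hF
  set E := ∑ u, ∑ v, w u v * (f u - f v) ^ 2 with hE
  have hF0 : 0 ≤ F := Finset.sum_nonneg fun i _ => sq_nonneg _
  have hE0 : 0 ≤ E := Finset.sum_nonneg fun u _ => Finset.sum_nonneg fun v _ =>
    mul_nonneg (hw u v) (sq_nonneg _)
  have hP : ∑ u, ∑ v, w u v * (f u + f v) ^ 2 ≤ 4 * D * F := by
    have ha : ∑ u, ∑ v, w u v * f u ^ 2 ≤ D * F := by
      rw [hF, Finset.mul_sum]
      refine Finset.sum_le_sum fun u _ => ?_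
      rw [← Finset.sum_mul]
      exact mul_le_mul_of_nonneg_right (hdeg u) (sq_nonneg _)
    have hb : ∑ u, ∑ v, w u v * f v ^ 2 = ∑ u, ∑ v, w u v * f u ^ 2 := by
      rw [Finset.sum_comm]
      exact Finset.sum_congr rfl fun u _ => Finset.sum_congr rfl fun v _ => by rw [hsymm]
    have hc : ∑ u, ∑ v, w u v * (f u + f v) ^ 2 ≤
        ∑ u, ∑ v, (2 * (w u v * f u ^ 2) + 2 * (w u v * f v ^ 2)) := by
      refine Finset.sum_le_sum fun u _ => Finset.sum_le_sum fun v _ => ?_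
      nlinarith [mul_nonneg (hw u v) (sq_nonneg (f u - f v))]
    simp only [Finset.sum_add_distrib, ← Finset.mul_sum] at hc
    linarith
  -- Cauchy–Schwarz after factoring f u² − f v² = (f u − f v)(f u + f v).
  have hCS : (β * F) ^ 2 ≤ E * (4 * D * F) := by
    have h2 : ∑ u, ∑ v, w u v * max (f u ^ 2 - f v ^ 2) 0 ≤
        ∑ x : ι × ι, (Real.sqrt (w x.1 x.2) * |f x.1 - f x.2|) *
          (Real.sqrt (w x.1 x.2) * (f x.1 + f x.2)) := by
      rw [Fintype.sum_prod_type]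
      refine Finset.sum_le_sum fun u _ => Finset.sum_le_sum fun v _ => ?_
      have h3 : max (f u ^ 2 - f v ^ 2) 0 ≤ |f u - f v| * (f u + f v) := by
        have h4 := add_nonneg (hf u) (hf v)
        refine max_le ?_ (mul_nonneg (abs_nonneg _) h4)
        nlinarith [le_abs_self (f u - f v)]
      calc _ ≤ w u v * (|f u - f v| * (f u + f v)) := mul_le_mul_of_nonneg_left h3 (hw u v)
        _ = (Real.sqrt (w u v) * Real.sqrt (w u v)) * (|f u - f v| * (f u + f v)) := by
          rw [Real.mul_self_sqrt (hw u v)]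
        _ = _ := by ring
    have h3 := Finset.sum_mul_sq_le_sq_mul_sq (Finset.univ : Finset (ι × ι))
      (fun x => Real.sqrt (w x.1 x.2) * |f x.1 - f x.2|)
      (fun x => Real.sqrt (w x.1 x.2) * (f x.1 + f x.2))
    simp only [mul_pow, Real.sq_sqrt (hw _ _), sq_abs] at h3
    rw [Fintype.sum_prod_type (f := fun x : ι × ι => w x.1 x.2 * (f x.1 - f x.2) ^ 2),
      Fintype.sum_prod_type (f := fun x : ι × ι => w x.1 x.2 * (f x.1 + f x.2) ^ 2)] at h3
    have h4 : 0 ≤ β * F := mul_nonneg hβ hF0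
    calc (β * F) ^ 2 ≤ _ := pow_le_pow_left₀ h4 (h1.trans h2) 2
      _ ≤ _ := h3
      _ ≤ _ := mul_le_mul_of_nonneg_left hP hE0
  rcases hF0.eq_or_lt with h | h
  · rw [← h, mul_zero]; exact hE0
  · have : F * (β ^ 2 * F) ≤ F * (E * (4 * D)) := by linarith
    have := le_of_mul_le_mul_left this h
    rw [div_mul_eq_mul_div, div_le_iff₀ (by positivity)]
    exact this

/-- Take the least value with at most half of the points strictly above it. Were more than half
strictly below, the next smaller value would qualify too. -/
theorem exists_median [Nonempty ι] (y : ι → ℝ) :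
    ∃ m : ℝ, 2 * (Finset.univ.filter fun i => m < y i).card ≤ Fintype.card ι ∧
      2 * (Finset.univ.filter fun i => y i < m).card ≤ Fintype.card ι := by
  classical
  set C := Finset.univ.filter fun j =>
    2 * (Finset.univ.filter fun i => y j < y i).card ≤ Fintype.card ι with hC
  obtain ⟨M, -, hM⟩ := (Finset.univ : Finset ι).exists_max_image y Finset.univ_nonempty
  have hMC : M ∈ C := by
    rw [hC, Finset.mem_filter, Finset.filter_false_of_mem fun i hi => not_lt.2 (hM i hi)]
    simp
  obtain ⟨a, haC, hmin⟩ := C.exists_min_image y ⟨M, hMC⟩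
  refine ⟨y a, (Finset.mem_filter.1 haC).2, ?_⟩
  by_contra! hcon
  set B := Finset.univ.filter fun i => y i < y a with hB
  have hBne : B.Nonempty := by
    rw [← Finset.card_pos]
    omega
  obtain ⟨b, hbB, hmax⟩ := B.exists_max_image y hBne
  have hb : y b < y a := (Finset.mem_filter.1 hbB).2
  have hdisj : (Finset.univ.filter fun i => y b < y i) ⊆ Bᶜ := fun i hi => by
    rw [Finset.mem_compl]
    exact fun hiB => absurd (hmax i hiB) (not_le.2 (Finset.mem_filter.1 hi).2)
  have h1 := Finset.card_le_card hdisj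
  rw [Finset.card_compl] at h1
  have hbC : b ∈ C := Finset.mem_filter.2 ⟨Finset.mem_univ _, by omega⟩
  exact absurd (hmin b hbC) (not_le.2 hb)

/-- A Cheeger inequality: edge expansion and bounded degrees give a spectral gap. -/
theorem cheeger_inequality [DecidableEq ι] (w : ι → ι → ℝ) (hw : ∀ u v, 0 ≤ w u v)
    (hsymm : ∀ u v, w u v = w v u) (β D : ℝ) (hβ : 0 ≤ β) (hD : 0 < D)
    (hdeg : ∀ u, ∑ v, w u v ≤ D)
    (hexp : ∀ A : Finset ι, 2 * A.card ≤ Fintype.card ι →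
      β * A.card ≤ ∑ u ∈ A, ∑ v ∈ Aᶜ, w u v)
    (y : ι → ℝ) (hy : ∑ i, y i = 0) :
    β ^ 2 / (4 * D) * ∑ i, y i ^ 2 ≤ ∑ u, ∑ v, w u v * (y u - y v) ^ 2 := by
  cases isEmpty_or_nonempty ι
  · simp
  obtain ⟨m, hm1, hm2⟩ := exists_median y
  have hf := sum_sq_le_of_small_support w hw hsymm β D hβ hD hdeg hexp
    (fun i => max (y i - m) 0) (fun i => le_max_right _ _) (by simpa using hm1)
  have hg := sum_sq_le_of_small_support w hw hsymm β D hβ hD hdeg hexp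
    (fun i => max (m - y i) 0) (fun i => le_max_right _ _) (by simpa using hm2)
  -- Since `y` has mean zero, moving the centre to the median can only increase the sum of squares.
  have hsplit : ∑ i, y i ^ 2 ≤ ∑ i, max (y i - m) 0 ^ 2 + ∑ i, max (m - y i) 0 ^ 2 := by
    have h1 : ∑ i, (y i - m) ^ 2 = ∑ i, max (y i - m) 0 ^ 2 + ∑ i, max (m - y i) 0 ^ 2 := by
      rw [← Finset.sum_add_distrib]
      refine Finset.sum_congr rfl fun i _ => ?_
      rcases le_total (y i) m with h | h
      · rw [max_eq_right (by linarith), max_eq_left (by linarith)]; ring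
      · rw [max_eq_left (by linarith), max_eq_right (by linarith)]; ring
    have h2 : ∑ i, (y i - m) ^ 2 = ∑ i, y i ^ 2 - 2 * m * ∑ i, y i + Fintype.card ι * m ^ 2 := by
      simp only [sub_sq, Finset.sum_add_distrib, Finset.sum_sub_distrib, Finset.mul_sum,
        Finset.sum_const, Finset.card_univ, nsmul_eq_mul]
      congr 2
      exact Finset.sum_congr rfl fun i _ => by ring
    rw [hy] at h2
    have : 0 ≤ (Fintype.card ι : ℝ) * m ^ 2 := by positivity
    linarith
  -- For a pair straddling `m`, the two truncated differences have absolute values adding up to |y u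
  -- − y v|, so their squares add up to at most its square.
  have hE : ∑ u, ∑ v, w u v * (max (y u - m) 0 - max (y v - m) 0) ^ 2 +
      ∑ u, ∑ v, w u v * (max (m - y u) 0 - max (m - y v) 0) ^ 2 ≤
      ∑ u, ∑ v, w u v * (y u - y v) ^ 2 := by
    simp only [← Finset.sum_add_distrib, ← mul_add]
    refine Finset.sum_le_sum fun u _ => Finset.sum_le_sum fun v _ =>
      mul_le_mul_of_nonneg_left ?_ (hw u v)
    rcases le_total (y u) m with h | h <;> rcases le_total (y v) m with h' | h'
    · rw [max_eq_right (by linarith : y u - m ≤ 0), max_eq_right (by linarith : y v - m ≤ 0),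
        max_eq_left (by linarith), max_eq_left (by linarith)]
      nlinarith
    · rw [max_eq_right (by linarith : y u - m ≤ 0), max_eq_left (by linarith : 0 ≤ y v - m),
        max_eq_left (by linarith), max_eq_right (by linarith)]
      nlinarith
    · rw [max_eq_left (by linarith : 0 ≤ y u - m), max_eq_right (by linarith : y v - m ≤ 0),
        max_eq_right (by linarith), max_eq_left (by linarith)]
      nlinarith
    · rw [max_eq_left (by linarith : 0 ≤ y u - m), max_eq_left (by linarith : 0 ≤ y v - m),
        max_eq_right (by linarith), max_eq_right (by linarith)]
      nlinarith
  have hc : 0 ≤ β ^ 2 / (4 * D) := by positivity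
  have := mul_le_mul_of_nonneg_left hsplit hc
  linarith

end Cheeger

/-! ### Edges between two node sets. -/

section EdgeCount

variable {V : Type*}

open Classical in
/-- The number of ordered pairs in `A × B` that are joined by an edge, as a real number. -/
def edgeCount (G : SimpleGraph V) (A B : Finset V) : ℝ :=
  ∑ u ∈ A, ∑ v ∈ B, if G.Adj u v then 1 else 0

theorem edgeCount_nonneg (G : SimpleGraph V) (A B : Finset V) : 0 ≤ edgeCount G A B :=
  Finset.sum_nonneg fun _ _ => Finset.sum_nonneg fun _ _ => by split_ifs <;> norm_num

theorem edgeCount_le (G : SimpleGraph V) (A B : Finset V) :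
    edgeCount G A B ≤ A.card * B.card := by
  refine (Finset.sum_le_sum fun u _ => Finset.sum_le_sum fun v _ =>
    (by split_ifs <;> norm_num : _ ≤ (1 : ℝ))).trans ?_
  simp

open Classical in
theorem edgeCount_comm (G : SimpleGraph V) (A B : Finset V) :
    edgeCount G A B = edgeCount G B A := by
  rw [edgeCount, Finset.sum_comm]
  exact Finset.sum_congr rfl fun u _ => Finset.sum_congr rfl fun v _ =>
    if_congr (G.adj_comm v u) rfl rfl

end EdgeCount

/-! ### Spectral bounds for a fixed graph and grounded set. -/

section Deterministic

open Matrix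

variable {V : Type*} [Fintype V] [DecidableEq V]

theorem groundedEigenvalue_mul_le (G : SimpleGraph V) (S : Finset V) (hS : ∃ v, v ∉ S)
    (x : {v // v ∉ S} → ℝ) :
    groundedEigenvalue G S * (x ⬝ᵥ x) ≤ x ⬝ᵥ (groundedLaplacian G S *ᵥ x) := by
  have hA := isHermitian_groundedLaplacian G S
  have hleast := isLeast_groundedEigenvalue G S hS
  set l := groundedEigenvalue G S
  have hpsd : (groundedLaplacian G S - algebraMap ℝ _ l).PosSemidef := by
    rw [posSemidef_iff_isHermitian_and_spectrum_nonneg]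
    refine ⟨hA.sub ?_, ?_⟩
    · rw [algebraMap_eq_diagonal]
      exact isHermitian_diagonal _
    · rw [← spectrum.sub_singleton_eq]
      rintro _ ⟨μ, hμ, _, rfl, rfl⟩
      have : l ≤ μ := hleast.2 (by
        rw [Set.mem_ofPred_eq, Module.End.hasEigenvalue_iff_mem_spectrum, spectrum_toLin']
        exact hμ)
      simpa using this
  have := hpsd.dotProduct_mulVec_nonneg x
  rw [star_trivial, sub_mulVec, dotProduct_sub, Algebra.algebraMap_eq_smul_one, smul_mulVec, one_mulVec,
    dotProduct_smul, smul_eq_mul] at this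
  linarith

theorem le_groundedEigenvalue (G : SimpleGraph V) (S : Finset V) (hS : ∃ v, v ∉ S) (κ : ℝ)
    (h : ∀ x : {v // v ∉ S} → ℝ, κ * (x ⬝ᵥ x) ≤ x ⬝ᵥ (groundedLaplacian G S *ᵥ x)) :
    κ ≤ groundedEigenvalue G S := by
  obtain ⟨x, hx⟩ := (isLeast_groundedEigenvalue G S hS).1.exists_hasEigenvector
  have h1 := hx.apply_eq_smul
  rw [toLin'_apply] at h1
  have h2 := h x
  rw [h1, dotProduct_smul, smul_eq_mul] at h2
  have h3 : 0 < x ⬝ᵥ x := by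
    refine lt_of_le_of_ne (Finset.sum_nonneg fun i _ => mul_self_nonneg _) fun h0 => hx.2 ?_
    exact dotProduct_self_eq_zero.1 h0.symm
  exact le_of_mul_le_mul_right h2 h3

open Classical in
theorem sum_subtype_notMem (S : Finset V) (f : V → ℝ) :
    ∑ v : {v // v ∉ S}, f v = ∑ v ∈ Sᶜ, f v :=
  (Finset.sum_subtype Sᶜ (fun x => by simp) f).symm

-- Deleting rows and columns leaves full degrees on the diagonal, so edges into `S` survive as a
-- mass term. The energy runs over ordered pairs, hence the division by 2.
open Classical in
theorem dotProduct_groundedLaplacian_mulVec (G : SimpleGraph V) (S : Finset V)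
    (x : {v // v ∉ S} → ℝ) :
    x ⬝ᵥ (groundedLaplacian G S *ᵥ x) =
      (∑ u : {v // v ∉ S}, ∑ v : {v // v ∉ S},
        (if G.Adj u v then (1 : ℝ) else 0) * (x u - x v) ^ 2) / 2 +
      ∑ v : {v // v ∉ S}, edgeCount G {v.1} S * x v ^ 2 := by
  set a : {v // v ∉ S} → {v // v ∉ S} → ℝ := fun u v => if G.Adj u v then 1 else 0 with ha
  have hsymm : ∀ u v, a u v = a v u := fun u v => by simp only [ha, G.adj_comm]
  have hmul : ∀ u, (groundedLaplacian G S *ᵥ x) u =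
      (∑ v, a u v + edgeCount G {u.1} S) * x u - ∑ v, a u v * x v := by
    intro u
    have hd : (G.degree u.1 : ℝ) = ∑ v, a u v + edgeCount G {u.1} S := by
      rw [G.degree_eq_sum_if_adj (R := ℝ)]
      simp only [ha, edgeCount, Finset.sum_singleton]
      rw [sum_subtype_notMem S fun v => if G.Adj u.1 v then (1 : ℝ) else 0, add_comm,
        Finset.sum_add_sum_compl]
    rw [← hd]
    simp only [mulVec, dotProduct, groundedLaplacian, submatrix_apply, SimpleGraph.lapMatrix,
      SimpleGraph.degMatrix, Matrix.sub_apply, SimpleGraph.adjMatrix_apply, sub_mul,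
      Finset.sum_sub_distrib]
    congr 1
    rw [Finset.sum_eq_single u]
    · simp
    · intro v _ hv
      rw [diagonal_apply_ne _ fun h => hv (Subtype.ext h.symm), zero_mul]
    · simp
  have hE : ∑ u, ∑ v, a u v * (x u - x v) ^ 2 =
      2 * ∑ u, ∑ v, (a u v * x u ^ 2 - a u v * (x u * x v)) := by
    have h1 : ∑ u, ∑ v, a u v * x v ^ 2 = ∑ u, ∑ v, a u v * x u ^ 2 := by
      rw [Finset.sum_comm]
      exact Finset.sum_congr rfl fun u _ => Finset.sum_congr rfl fun v _ => by rw [hsymm]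
    have h2 : ∑ u, ∑ v, a u v * (x u - x v) ^ 2 =
        ∑ u, ∑ v, (a u v * x u ^ 2 + a u v * x v ^ 2 - 2 * (a u v * (x u * x v))) :=
      Finset.sum_congr rfl fun u _ => Finset.sum_congr rfl fun v _ => by ring
    rw [h2]
    simp only [Finset.sum_sub_distrib, Finset.sum_add_distrib, h1, ← Finset.mul_sum]
    ring
  rw [hE, mul_div_cancel_left₀ _ (two_ne_zero), ← Finset.sum_add_distrib]
  refine Finset.sum_congr rfl fun u _ => ?_
  rw [hmul, Finset.sum_sub_distrib, ← Finset.sum_mul, mul_sub, Finset.mul_sum]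
  have : ∑ v, a u v * (x u * x v) = ∑ v, x u * (a u v * x v) :=
    Finset.sum_congr rfl fun v _ => by ring
  rw [this]
  ring

theorem sum_edgeCount_singleton (G : SimpleGraph V) (S : Finset V) :
    ∑ v : {v // v ∉ S}, edgeCount G {v.1} S = edgeCount G S Sᶜ := by
  rw [sum_subtype_notMem S fun v => edgeCount G {v} S, edgeCount_comm]
  simp [edgeCount]

theorem card_notMem_eq (S : Finset V) : Fintype.card {v // v ∉ S} = Sᶜ.card :=
  Fintype.card_of_subtype Sᶜ (by simp)

/-- Rayleigh bound with the all-ones vector. -/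
theorem groundedEigenvalue_mul_card_le (G : SimpleGraph V) (S : Finset V) (hS : ∃ v, v ∉ S) :
    groundedEigenvalue G S * Sᶜ.card ≤ edgeCount G S Sᶜ := by
  have h := groundedEigenvalue_mul_le G S hS fun _ => 1
  rw [dotProduct_groundedLaplacian_mulVec] at h
  simpa [sum_edgeCount_singleton, dotProduct, ← card_notMem_eq] using h

/-- Edge expansion and bounded degrees outside `S` give a lower bound on the grounded eigenvalue in
terms of the edge boundary of `S`. -/
theorem le_groundedEigenvalue_of_expansion (G : SimpleGraph V) (S : Finset V) (hS : ∃ v, v ∉ S)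
    (β D m κ : ℝ) (hβ : 0 < β) (hD : 0 < D) (hm : m = β ^ 2 / (8 * D))
    (hdeg : ∀ u ∉ S, edgeCount G {u} (Sᶜ \ {u}) ≤ D)
    (hexp : ∀ A ⊆ Sᶜ, A.Nonempty → 2 * A.card ≤ Sᶜ.card →
      β * A.card ≤ edgeCount G A (Sᶜ \ A))
    (hκ : κ ≤ m / 2)
    (hbd : κ * Sᶜ.card ≤ edgeCount G S Sᶜ * (1 - 2 * S.card / m)) :
    κ ≤ groundedEigenvalue G S := by
  classical
  have hm0 : 0 < m := by rw [hm]; positivity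
  refine le_groundedEigenvalue G S hS κ fun x => ?_
  rw [dotProduct_groundedLaplacian_mulVec]
  set N : ℝ := (Sᶜ.card : ℝ) with hN
  have hN0 : 0 < N := by
    obtain ⟨v, hv⟩ := hS
    exact Nat.cast_pos.2 (Finset.card_pos.2 ⟨v, by simpa using hv⟩)
  set a : ℝ := (∑ i, x i) / N with ha
  set y : {v // v ∉ S} → ℝ := fun i => x i - a with hy
  have hcard : ((Finset.univ : Finset {v // v ∉ S}).card : ℝ) = N := by
    rw [Finset.card_univ, card_notMem_eq]
  have hy0 : ∑ i, y i = 0 := by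
    simp only [hy, Finset.sum_sub_distrib, Finset.sum_const, nsmul_eq_mul, hcard, ha]
    field_simp
    ring
  have hch := cheeger_inequality (fun u v : {v // v ∉ S} => if G.Adj u v then (1 : ℝ) else 0)
    (fun u v => by split_ifs <;> norm_num) (fun u v => by simp only [G.adj_comm]) β D hβ.le hD
    (fun u => by
      refine le_trans (le_of_eq ?_) (hdeg u u.2)
      rw [sum_subtype_notMem S fun v => if G.Adj u.1 v then (1 : ℝ) else 0, edgeCount,
        Finset.sum_singleton]
      refine (Finset.sum_subset Finset.sdiff_subset fun v _ hv' => ?_).symm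
      have : v = u.1 := by
        by_contra hne
        exact hv' (by simp_all)
      simp [this])
    (fun A hA => by
      rcases A.eq_empty_or_nonempty with rfl | hne
      · simp
      have h1 := hexp (A.map (Function.Embedding.subtype _))
        (fun v hv => by
          obtain ⟨w, -, rfl⟩ := Finset.mem_map.1 hv
          simpa using w.2)
        (by simpa using hne) (by simpa [← card_notMem_eq] using hA)
      rw [Finset.card_map] at h1
      refine h1.trans (le_of_eq ?_)
      rw [edgeCount, Finset.sum_map]
      refine Finset.sum_congr rfl fun u _ => ?_
      have h2 : Sᶜ \ A.map (Function.Embedding.subtype _) =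
          Aᶜ.map (Function.Embedding.subtype fun v => v ∉ S) := by
        ext v
        simp
        tauto
      rw [h2, Finset.sum_map]
      rfl)
    y hy0
  have hxy : ∀ u v, x u - x v = y u - y v := fun u v => by simp only [hy]; ring
  simp only [hxy]
  set E := ∑ u : {v // v ∉ S}, ∑ v : {v // v ∉ S},
    (if G.Adj u v then (1 : ℝ) else 0) * (y u - y v) ^ 2
  -- The 8 in `m`, against the 4 in Cheeger's inequality, is this passage from ordered to unordered
  -- pairs.
  have hE : m * ∑ i, y i ^ 2 ≤ E / 2 := by
    have : m = β ^ 2 / (4 * D) / 2 := by rw [hm]; field_simp; norm_num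
    rw [this]
    linarith
  have hxx : x ⬝ᵥ x = N * a ^ 2 + ∑ i, y i ^ 2 := by
    have h1 : x ⬝ᵥ x = ∑ i, (a ^ 2 + 2 * a * y i + y i ^ 2) :=
      Finset.sum_congr rfl fun i _ => by simp only [hy]; ring
    rw [h1]
    simp only [Finset.sum_add_distrib, ← Finset.mul_sum, hy0, Finset.sum_const, nsmul_eq_mul, hcard]
    ring
  -- Expand d(a + y)², drop dy², and absorb the cross term 2ady by completing a square with half of
  -- the gap. The loss 2a²d²/m is linearised by d ≤ |S|.
  have hdS : a ^ 2 * (edgeCount G S Sᶜ * (1 - 2 * S.card / m)) - m / 2 * ∑ i, y i ^ 2 ≤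
      ∑ v : {v // v ∉ S}, edgeCount G {v.1} S * x v ^ 2 := by
    rw [← sum_edgeCount_singleton, Finset.sum_mul, Finset.mul_sum, Finset.mul_sum,
      ← Finset.sum_sub_distrib]
    refine Finset.sum_le_sum fun v _ => ?_
    have hd0 := edgeCount_nonneg G {v.1} S
    have hdk : edgeCount G {v.1} S ≤ S.card := by simpa using edgeCount_le G {v.1} S
    set d := edgeCount G {v.1} S
    have hx : x v = a + y v := by simp only [hy]; ring
    have h1 : 0 ≤ m / 2 * (y v + 2 * a * d / m) ^ 2 := by positivity
    have h2 : m / 2 * (y v + 2 * a * d / m) ^ 2 =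
        m / 2 * y v ^ 2 + 2 * a * d * y v + 2 * a ^ 2 * d * d / m := by
      field_simp
      ring
    have h3 : 2 * a ^ 2 * d * d / m ≤ 2 * a ^ 2 * d * S.card / m := by
      gcongr
    have h4 : a ^ 2 * (d * (1 - 2 * S.card / m)) = a ^ 2 * d - 2 * a ^ 2 * d * S.card / m := by
      ring
    rw [hx, h4]
    nlinarith [mul_nonneg hd0 (sq_nonneg (y v))]
  rw [hxx]
  have h5 := mul_le_mul_of_nonneg_left hbd (sq_nonneg a)
  have h6 := mul_le_mul_of_nonneg_right hκ
    (Finset.sum_nonneg fun i (_ : i ∈ Finset.univ) => sq_nonneg (y i))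
  linarith

end Deterministic

/-! ### Exponential moments and Chernoff bounds for edge counts. -/

section Chernoff

variable {V : Type*}

instance [Countable V] : MeasurableSingletonClass (SimpleGraph V) where
  measurableSet_singleton G := by
    have h := SimpleGraph.measurableEmbedding_edgeSet (V := V)
    rw [← h.measurableSet_image, Set.image_singleton]
    exact measurableSet_singleton _

variable [Fintype V] [DecidableEq V]

open Classical in
theorem binomialRandom_real_singleton (p : unitInterval) (G : SimpleGraph V) :
    (SimpleGraph.binomialRandom V p).real {G} = (p : ℝ) ^ G.edgeFinset.card *
      (1 - (p : ℝ)) ^ ((Finset.univ.filter fun e : Sym2 V => ¬ e.IsDiag) \ G.edgeFinset).card := by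
  have hcard : ((Finset.univ.filter fun e : Sym2 V => ¬ e.IsDiag) \ G.edgeFinset).card =
      (Nat.card V).choose 2 - G.edgeSet.ncard := by
    rw [Finset.card_sdiff_of_subset, Nat.card_eq_fintype_card, ← Sym2.card_subtype_not_diag,
      Fintype.card_subtype, Set.ncard_eq_toFinset_card', SimpleGraph.edgeFinset]
    intro e he
    simpa using G.not_isDiag_of_mem_edgeSet (SimpleGraph.mem_edgeFinset.1 he)
  rw [measureReal_def, SimpleGraph.binomialRandom_singleton, hcard]
  simp [Set.ncard_eq_toFinset_card', SimpleGraph.edgeFinset]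

open Classical in
/-- The exponential moments of the number of edges of `G(V, p)` in a given set of pairs. -/
theorem sum_exp_mul_binomialRandom_le (p : unitInterval) (E : Finset (Sym2 V))
    (hE : ∀ e ∈ E, ¬ e.IsDiag) (t : ℝ) :
    ∑ G : SimpleGraph V, Real.exp (t * (E.filter (· ∈ G.edgeSet)).card) *
      (SimpleGraph.binomialRandom V p).real {G} ≤
      Real.exp (E.card * p * (Real.exp t - 1)) := by
  set U := Finset.univ.filter fun e : Sym2 V => ¬ e.IsDiag with hU
  have hp0 : 0 ≤ (p : ℝ) := p.2.1
  have hp1 : 0 ≤ 1 - (p : ℝ) := sub_nonneg.2 p.2.2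
  set c : Sym2 V → ℝ := fun e => if e ∈ E then Real.exp t else 1 with hc
  have hc0 : ∀ e, 0 ≤ c e := fun e => by simp only [hc]; split_ifs <;> positivity
  -- Tilted weight of the graph with edge set `T`; summed over all `T ⊆ U` it factors over the
  -- pairs, which encodes independence.
  set F : Finset (Sym2 V) → ℝ := fun T => (∏ e ∈ T, (p * c e)) * ∏ e ∈ U \ T, (1 - (p : ℝ)) with hF
  have hF0 : ∀ T, 0 ≤ F T := fun T =>
    mul_nonneg (Finset.prod_nonneg fun e _ => mul_nonneg hp0 (hc0 e))
      (Finset.prod_nonneg fun _ _ => hp1)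
  have hG : ∀ G : SimpleGraph V, Real.exp (t * (E.filter (· ∈ G.edgeSet)).card) *
      (SimpleGraph.binomialRandom V p).real {G} = F G.edgeFinset := fun G => by
    rw [binomialRandom_real_singleton]
    have h1 : ∏ e ∈ G.edgeFinset, c e = Real.exp (t * (E.filter (· ∈ G.edgeSet)).card) := by
      simp only [hc]
      rw [Finset.prod_ite_mem, Finset.prod_const, ← Real.exp_nat_mul, mul_comm]
      congr 4
      ext e
      simp [and_comm]
    simp only [hF, Finset.prod_mul_distrib, Finset.prod_const, h1]
    ring
  have hinj : Set.InjOn (fun G : SimpleGraph V => G.edgeFinset)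
      ((Finset.univ : Finset (SimpleGraph V)) : Set (SimpleGraph V)) :=
    fun G _ H _ h => SimpleGraph.edgeFinset_inj.1 h
  calc _ = ∑ T ∈ Finset.univ.image (fun G : SimpleGraph V => G.edgeFinset), F T := by
        rw [Finset.sum_image hinj]
        exact Finset.sum_congr rfl fun G _ => hG G
    _ ≤ ∑ T ∈ U.powerset, F T := by
        refine Finset.sum_le_sum_of_subset_of_nonneg (fun T hT => ?_) fun T _ _ => hF0 T
        obtain ⟨G, -, rfl⟩ := Finset.mem_image.1 hT
        refine Finset.mem_powerset.2 fun e he => ?_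
        simpa [hU] using G.not_isDiag_of_mem_edgeSet (SimpleGraph.mem_edgeFinset.1 he)
    _ = ∏ e ∈ U, (p * c e + (1 - (p : ℝ))) := (Finset.prod_add _ _ _).symm
    _ = ∏ e ∈ U, if e ∈ E then 1 + p * (Real.exp t - 1) else 1 := by
        refine Finset.prod_congr rfl fun e _ => ?_
        by_cases h : e ∈ E <;> simp only [hc, h, if_true, if_false] <;> ring
    _ = (1 + p * (Real.exp t - 1)) ^ E.card := by
        rw [Finset.prod_ite_mem, Finset.prod_const]
        congr 2
        exact Finset.inter_eq_right.2 fun e he => by simpa [hU] using hE e he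
    _ ≤ Real.exp (p * (Real.exp t - 1)) ^ E.card := by
        refine pow_le_pow_left₀ ?_ (by linarith [Real.add_one_le_exp (p * (Real.exp t - 1))]) _
        nlinarith [mul_nonneg hp0 (Real.exp_pos t).le]
    _ = _ := by
        rw [← Real.exp_nat_mul]
        ring_nf

open Classical in
/-- Chernoff's bound for the number of edges of `G(V, p)` in a given set of pairs. -/
theorem binomialRandom_real_le_exp (p : unitInterval) (E : Finset (Sym2 V))
    (hE : ∀ e ∈ E, ¬ e.IsDiag) (t a : ℝ) :
    (SimpleGraph.binomialRandom V p).real {G | a ≤ t * (E.filter (· ∈ G.edgeSet)).card} ≤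
      Real.exp (E.card * p * (Real.exp t - 1) - a) := by
  have h1 : (SimpleGraph.binomialRandom V p).real
      {G | a ≤ t * (E.filter (· ∈ G.edgeSet)).card} =
      ∑ G with a ≤ t * (E.filter (· ∈ G.edgeSet)).card,
        (SimpleGraph.binomialRandom V p).real {G} := by
    rw [sum_measureReal_singleton]
    congr 1
    ext G
    simp
  -- Markov's inequality. With the event written as a ≤ t·count, t < 0 gives lower tails and t > 0
  -- upper tails.
  rw [h1, Real.exp_sub, le_div_iff₀ (Real.exp_pos a)]
  refine le_trans ?_ (sum_exp_mul_binomialRandom_le p E hE t)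
  rw [Finset.sum_mul]
  refine (Finset.sum_le_sum fun G hG => ?_).trans
    (Finset.sum_le_sum_of_subset_of_nonneg (Finset.filter_subset _ _) fun G _ _ =>
      mul_nonneg (Real.exp_pos _).le measureReal_nonneg)
  rw [mul_comm]
  exact mul_le_mul_of_nonneg_right (Real.exp_le_exp.2 (Finset.mem_filter.1 hG).2)
    measureReal_nonneg

/-- Chernoff's bound for the number of edges of `G(V, p)` between two disjoint sets. -/
theorem binomialRandom_real_edgeCount_le_exp (p : unitInterval) (A B : Finset V)
    (hAB : Disjoint A B) (t a : ℝ) :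
    (SimpleGraph.binomialRandom V p).real {G | a ≤ t * edgeCount G A B} ≤
      Real.exp (A.card * B.card * p * (Real.exp t - 1) - a) := by
  classical
  have hinj : Set.InjOn (fun x : V × V => s(x.1, x.2)) (A ×ˢ B : Finset (V × V)) := by
    rintro ⟨a, b⟩ hx ⟨c, d⟩ hy h
    simp only [Finset.coe_product, Set.mem_prod, Finset.mem_coe] at hx hy
    rcases Sym2.eq_iff.1 h with ⟨rfl, rfl⟩ | ⟨rfl, rfl⟩
    · rfl
    · exact absurd hy.2 (Finset.disjoint_left.1 hAB hx.1)
  set E := (A ×ˢ B).image fun x : V × V => s(x.1, x.2) with hE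
  have hcard : (E.card : ℝ) = A.card * B.card := by
    rw [hE, Finset.card_image_of_injOn hinj, Finset.card_product, Nat.cast_mul]
  have hcount : ∀ G : SimpleGraph V, ((E.filter (· ∈ G.edgeSet)).card : ℝ) = edgeCount G A B := by
    intro G
    rw [Finset.card_filter, hE, Finset.sum_image hinj, Finset.sum_product, edgeCount]
    push_cast
    refine Finset.sum_congr rfl fun u _ => Finset.sum_congr rfl fun v _ => ?_
    simp only [SimpleGraph.mem_edgeSet]
  have := binomialRandom_real_le_exp p E (fun e he => by
    obtain ⟨⟨u, v⟩, hx, rfl⟩ := Finset.mem_image.1 he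
    rw [Finset.mem_product] at hx
    rw [Sym2.mk_isDiag_iff]
    intro h
    have huv : u = v := h
    exact Finset.disjoint_left.1 hAB hx.1 (huv ▸ hx.2)) t a
  simpa only [hcount, hcard] using this

end Chernoff

/-! ### Failure probabilities for a fixed grounded set. -/

section Concentration

variable {V : Type*} [Fintype V] [DecidableEq V]

/-- Union bound for edge expansion in the complement of a fixed set of nodes. -/
theorem binomialRandom_real_not_expansion_le (p : unitInterval) (S : Finset V) (τ t c L : ℝ)
    (hτ0 : 0 < τ) (hτ1 : τ ≤ 1) (ht : t = Real.log (8 / τ)) (hc : c = τ / (16 * t))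
    (hL : L = Fintype.card V * (p : ℝ)) (hcard : 0 < Fintype.card V)
    (hS : (S.card : ℝ) ≤ τ / 16 * Fintype.card V) :
    (SimpleGraph.binomialRandom V p).real {G | ∃ A ⊆ Sᶜ, A.Nonempty ∧ 2 * A.card ≤ Sᶜ.card ∧
      edgeCount G A (Sᶜ \ A) < c * L * A.card} ≤
      (1 + Real.exp (-(1 - τ / 2) * L)) ^ Fintype.card V - 1 +
        (2 * Real.exp (-(τ * L / 32))) ^ Fintype.card V := by
  set n := Fintype.card V with hn
  set q := Real.exp (-(1 - τ / 2) * L) with hq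
  set r := Real.exp (-(τ * L / 32)) with hr
  have hn0 : (0 : ℝ) < n := Nat.cast_pos.2 hcard
  have hp0 : 0 ≤ (p : ℝ) := p.2.1
  have hL0 : 0 ≤ L := by rw [hL]; positivity
  have ht0 : 0 < t := by
    rw [ht]
    exact Real.log_pos (by rw [lt_div_iff₀ hτ0]; linarith)
  have hexp : Real.exp (-t) = τ / 8 := by
    rw [ht, Real.exp_neg, Real.exp_log (by positivity), inv_div]
  have htc : t * c = τ / 16 := by
    rw [hc]; field_simp
  have hp : (p : ℝ) = L / n := by rw [hL]; field_simp
  have hA : ∀ A : Finset V, A ⊆ Sᶜ → 2 * A.card ≤ Sᶜ.card →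
      (SimpleGraph.binomialRandom V p).real {G | edgeCount G A (Sᶜ \ A) < c * L * A.card} ≤
        q ^ A.card + r ^ n := by
    intro A hAS hA2
    set s : ℝ := (A.card : ℝ) with hs
    set b : ℝ := ((Sᶜ \ A).card : ℝ) with hb
    have hbn : b = n - S.card - s := by
      rw [hb, Finset.card_sdiff_of_subset hAS, Nat.cast_sub (Finset.card_le_card hAS),
        Finset.card_compl, Nat.cast_sub (Finset.card_le_univ S)]
    have hA2' : 2 * s ≤ n - S.card := by
      have : (2 * A.card : ℝ) ≤ Sᶜ.card := by exact_mod_cast hA2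
      rwa [Finset.card_compl, Nat.cast_sub (Finset.card_le_univ S)] at this
    -- The tilt −t has e^(−t) = τ/8, and c is tuned so that tc = τ/16: together they cost less than
    -- τ/2 in the exponent for small `A`.
    have h1 := binomialRandom_real_edgeCount_le_exp p A (Sᶜ \ A) Finset.disjoint_sdiff
      (-t) (-t * (c * L * s))
    rw [hexp] at h1
    have h2 : s * b * p * (τ / 8 - 1) - -t * (c * L * s) =
        -(s * L * ((1 - τ / 8) * (b / n) - τ / 16)) := by
      rw [hp, ← htc]; ring
    rw [← hs, ← hb, h2] at h1
    have h3 : (SimpleGraph.binomialRandom V p).real {G | edgeCount G A (Sᶜ \ A) < c * L * s} ≤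
        Real.exp (-(s * L * ((1 - τ / 8) * (b / n) - τ / 16))) := by
      refine (measureReal_mono fun G hG => ?_).trans h1
      have hG' : edgeCount G A (Sᶜ \ A) < c * L * s := hG
      show -t * (c * L * s) ≤ -t * edgeCount G A (Sᶜ \ A)
      nlinarith
    refine h3.trans ?_
    have hs0 : 0 ≤ s := Nat.cast_nonneg _
    -- Small sets see almost all of the nodes, giving the sharp rate 1 − τ/2. For large ones rate
    -- 1/4 suffices: s ≥ τn/8 yields exp(−τnL/32), which beats the 2ⁿ choices of `A`.
    rcases le_total s (τ / 8 * n) with hsn | hsn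
    · have h4 : 1 - τ / 8 - τ / 16 ≤ b / n := by
        rw [le_div_iff₀ hn0]; linarith
      have h5 : 1 - τ / 2 ≤ (1 - τ / 8) * (b / n) - τ / 16 := by nlinarith
      have h6 : Real.exp (-(s * L * ((1 - τ / 8) * (b / n) - τ / 16))) ≤ q ^ A.card := by
        rw [hq, ← Real.exp_nat_mul, Real.exp_le_exp, ← hs]
        have := mul_le_mul_of_nonneg_left h5 (mul_nonneg hs0 hL0)
        linarith
      have : 0 ≤ r ^ n := by positivity
      linarith
    · have h4 : 15 / 32 ≤ b / n := by
        rw [le_div_iff₀ hn0]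
        nlinarith
      have h5 : 1 / 4 ≤ (1 - τ / 8) * (b / n) - τ / 16 := by nlinarith
      have h6 : Real.exp (-(s * L * ((1 - τ / 8) * (b / n) - τ / 16))) ≤ r ^ n := by
        rw [hr, ← Real.exp_nat_mul, Real.exp_le_exp]
        have h7 := mul_le_mul_of_nonneg_left h5 (mul_nonneg hs0 hL0)
        have h8 := mul_le_mul_of_nonneg_right hsn hL0
        linarith
      have : 0 ≤ q ^ A.card := by positivity
      linarith
  set T := (Finset.univ : Finset (Finset V)).filter
    fun A => A ⊆ Sᶜ ∧ A.Nonempty ∧ 2 * A.card ≤ Sᶜ.card with hT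
  have hcover : {G : SimpleGraph V | ∃ A ⊆ Sᶜ, A.Nonempty ∧ 2 * A.card ≤ Sᶜ.card ∧
      edgeCount G A (Sᶜ \ A) < c * L * A.card} ⊆
      ⋃ A ∈ T, {G | edgeCount G A (Sᶜ \ A) < c * L * A.card} := by
    rintro G ⟨A, h1, h2, h3, h4⟩
    refine Set.mem_biUnion (x := A) ?_ h4
    simpa [hT, h1, h2] using h3
  have hpow : ∑ A : Finset V, q ^ A.card = (1 + q) ^ n := by
    have := Fintype.sum_pow_mul_eq_add_pow V q 1
    simpa [add_comm] using this
  calc _ ≤ _ := measureReal_mono hcover (measure_ne_top _ _)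
    _ ≤ ∑ A ∈ T, (SimpleGraph.binomialRandom V p).real
        {G | edgeCount G A (Sᶜ \ A) < c * L * A.card} := measureReal_biUnion_finset_le _ _
    _ ≤ ∑ A ∈ T, (q ^ A.card + r ^ n) := Finset.sum_le_sum fun A hAT => by
        have := (Finset.mem_filter.1 hAT).2
        exact hA A this.1 this.2.2
    _ ≤ ∑ A ∈ (Finset.univ : Finset (Finset V)).erase ∅, (q ^ A.card + r ^ n) := by
        refine Finset.sum_le_sum_of_subset_of_nonneg (fun A hAT => ?_) fun A _ _ => by positivity
        have := (Finset.mem_filter.1 hAT).2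
        simp [this.2.1.ne_empty]
    _ ≤ _ := by
        rw [Finset.sum_add_distrib]
        have h1 := Finset.sum_erase_eq_sub (f := fun A : Finset V => q ^ A.card)
          (Finset.mem_univ ∅)
        rw [h1, hpow]
        have h2 : ∑ A ∈ (Finset.univ : Finset (Finset V)).erase ∅, r ^ n ≤
            ∑ A : Finset V, r ^ n :=
          Finset.sum_le_sum_of_subset_of_nonneg (Finset.erase_subset _ _) fun _ _ _ => by positivity
        have h3 : ∑ A : Finset V, r ^ n = (2 * r) ^ n := by
          rw [Finset.sum_const, Finset.card_univ, Fintype.card_finset, nsmul_eq_mul, mul_pow]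
          push_cast
          rfl
        simp only [Finset.card_empty, pow_zero]
        linarith

/-- Chernoff with t = 1: each mean is at most L and e − 1 ≤ 2, so the exponent is at most 2L − 4L.
-/
theorem binomialRandom_real_lt_degree_le (p : unitInterval) (S : Finset V) (L : ℝ)
    (hL : L = Fintype.card V * (p : ℝ)) :
    (SimpleGraph.binomialRandom V p).real
      {G | ∃ u ∉ S, 4 * L < edgeCount G {u} (Sᶜ \ {u})} ≤
      Fintype.card V * Real.exp (-(2 * L)) := by
  have hp0 : 0 ≤ (p : ℝ) := p.2.1
  have hu : ∀ u : V, (SimpleGraph.binomialRandom V p).real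
      {G | 4 * L < edgeCount G {u} (Sᶜ \ {u})} ≤ Real.exp (-(2 * L)) := by
    intro u
    have h1 := binomialRandom_real_edgeCount_le_exp p {u} (Sᶜ \ {u}) Finset.disjoint_sdiff 1 (4 * L)
    refine (measureReal_mono fun G hG => ?_).trans (h1.trans ?_)
    · simpa using le_of_lt hG
    · rw [Real.exp_le_exp, Finset.card_singleton, Nat.cast_one, one_mul]
      have h2 : ((Sᶜ \ {u}).card : ℝ) ≤ Fintype.card V := by
        exact_mod_cast Finset.card_le_univ _
      have h3 : Real.exp 1 - 1 ≤ 2 := by linarith [Real.exp_one_lt_d9]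
      have h4 : 0 ≤ Real.exp 1 - 1 := by linarith [Real.add_one_le_exp 1]
      have h5 : ((Sᶜ \ {u}).card : ℝ) * p ≤ L := by
        rw [hL]; exact mul_le_mul_of_nonneg_right h2 hp0
      have h6 : 0 ≤ ((Sᶜ \ {u}).card : ℝ) * p := by positivity
      nlinarith
  calc _ ≤ (SimpleGraph.binomialRandom V p).real
        (⋃ u ∈ (Finset.univ : Finset V), {G | 4 * L < edgeCount G {u} (Sᶜ \ {u})}) := by
        refine measureReal_mono ?_ (measure_ne_top _ _)
        rintro G ⟨u, -, h⟩
        exact Set.mem_biUnion (x := u) (by simp) h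
    _ ≤ ∑ u : V, (SimpleGraph.binomialRandom V p).real
        {G | 4 * L < edgeCount G {u} (Sᶜ \ {u})} := measureReal_biUnion_finset_le _ _
    _ ≤ ∑ u : V, Real.exp (-(2 * L)) := Finset.sum_le_sum fun u _ => hu u
    _ = _ := by simp

/-- Chernoff with t = ±δ/2; then e^t − 1 ≤ t + t² leaves −Mδ²/4 in both tails. -/
theorem binomialRandom_real_boundary_le (p : unitInterval) (S : Finset V) (δ M : ℝ)
    (hδ0 : 0 < δ) (hδ1 : δ ≤ 1) (hM : M = S.card * Sᶜ.card * (p : ℝ)) :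
    (SimpleGraph.binomialRandom V p).real
      {G | edgeCount G S Sᶜ < (1 - δ) * M ∨ (1 + δ) * M < edgeCount G S Sᶜ} ≤
      2 * Real.exp (-(M * δ ^ 2 / 4)) := by
  have hp0 : 0 ≤ (p : ℝ) := p.2.1
  have hM0 : 0 ≤ M := by rw [hM]; positivity
  have hexp : ∀ t : ℝ, |t| ≤ 1 → Real.exp t - 1 ≤ t + t ^ 2 := fun t ht => by
    have := (abs_le.1 (Real.abs_exp_sub_one_sub_id_le ht)).2
    linarith
  have h1 := binomialRandom_real_edgeCount_le_exp p S Sᶜ disjoint_compl_right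
    (-(δ / 2)) (-(δ / 2) * ((1 - δ) * M))
  have h2 := binomialRandom_real_edgeCount_le_exp p S Sᶜ disjoint_compl_right
    (δ / 2) ((δ / 2) * ((1 + δ) * M))
  rw [← hM] at h1 h2
  have e1 := mul_le_mul_of_nonneg_left (hexp (-(δ / 2)) (by
    rw [abs_le]; constructor <;> linarith)) hM0
  have e2 := mul_le_mul_of_nonneg_left (hexp (δ / 2) (by
    rw [abs_le]; constructor <;> linarith)) hM0
  have h1' := h1.trans (Real.exp_le_exp.2 (by linarith : _ ≤ -(M * δ ^ 2 / 4)))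
  have h2' := h2.trans (Real.exp_le_exp.2 (by linarith : _ ≤ -(M * δ ^ 2 / 4)))
  rw [Set.ofPred_or]
  refine (measureReal_union_le _ _).trans ?_
  have m1 : (SimpleGraph.binomialRandom V p).real {G | edgeCount G S Sᶜ < (1 - δ) * M} ≤ _ :=
    (measureReal_mono fun G hG => by
      have hG' : edgeCount G S Sᶜ < (1 - δ) * M := hG
      show -(δ / 2) * ((1 - δ) * M) ≤ -(δ / 2) * edgeCount G S Sᶜ
      nlinarith).trans h1'
  have m2 : (SimpleGraph.binomialRandom V p).real {G | (1 + δ) * M < edgeCount G S Sᶜ} ≤ _ :=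
    (measureReal_mono fun G hG => by
      have hG' : (1 + δ) * M < edgeCount G S Sᶜ := hG
      show (δ / 2) * ((1 + δ) * M) ≤ (δ / 2) * edgeCount G S Sᶜ
      nlinarith).trans h2'
  linarith

/-- For a fixed grounded set, the grounded eigenvalue of `G(V, p)` is close to `|S| p` with an
explicit failure probability. -/
theorem binomialRandom_real_groundedEigenvalue_le (p : unitInterval) (S : Finset V)
    (τ t c L m δ : ℝ) (hτ0 : 0 < τ) (hτ1 : τ ≤ 1) (ht : t = Real.log (8 / τ))
    (hc : c = τ / (16 * t)) (hL : L = Fintype.card V * (p : ℝ)) (hL0 : 0 < L)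
    (hm : m = c ^ 2 * L / 32)
    (hS : (S.card : ℝ) ≤ τ / 16 * Fintype.card V) (hS1 : 1 ≤ S.card)
    (hSm : 2 * (S.card : ℝ) ≤ m) (hδ0 : 0 < δ) (hδ1 : δ ≤ 1) :
    (SimpleGraph.binomialRandom V p).real
      {G | ¬ ((1 - (δ + 2 * S.card / m)) * (S.card * (p : ℝ)) ≤ groundedEigenvalue G S ∧
        groundedEigenvalue G S ≤ (1 + (δ + 2 * S.card / m)) * (S.card * (p : ℝ)))} ≤
      2 * Real.exp (-(L * δ ^ 2 / 8)) + Fintype.card V * Real.exp (-(2 * L)) +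
      ((1 + Real.exp (-(1 - τ / 2) * L)) ^ Fintype.card V - 1 +
        (2 * Real.exp (-(τ * L / 32))) ^ Fintype.card V) := by
  set M : ℝ := S.card * Sᶜ.card * (p : ℝ) with hM
  have hp0 : 0 ≤ (p : ℝ) := p.2.1
  have hp1 : (p : ℝ) ≤ 1 := p.2.2
  have hcardpos : 0 < Fintype.card V := by
    rcases Nat.eq_zero_or_pos (Fintype.card V) with h | h
    · rw [hL, h] at hL0; simp at hL0
    · exact h
  have hn0 : (0 : ℝ) < Fintype.card V := Nat.cast_pos.2 hcardpos
  have hS1' : (1 : ℝ) ≤ S.card := by exact_mod_cast hS1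
  have hN : (Sᶜ.card : ℝ) = Fintype.card V - S.card := by
    rw [Finset.card_compl, Nat.cast_sub (Finset.card_le_univ S)]
  have hN2 : (Fintype.card V : ℝ) / 2 ≤ Sᶜ.card := by rw [hN]; nlinarith
  have hN0 : (0 : ℝ) < Sᶜ.card := by linarith
  have hSne : ∃ v, v ∉ S := by
    obtain ⟨v, hv⟩ := Finset.card_pos.1 (Nat.cast_pos.1 hN0)
    exact ⟨v, by simpa using hv⟩
  have ht0 : 0 < t := by
    rw [ht]
    exact Real.log_pos (by rw [lt_div_iff₀ hτ0]; linarith)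
  have hc0 : 0 < c := by rw [hc]; positivity
  have hm0 : 0 < m := by rw [hm]; positivity
  have hML : L / 2 ≤ M := by
    have h1 : (Fintype.card V : ℝ) / 2 ≤ S.card * Sᶜ.card := by nlinarith
    have := mul_le_mul_of_nonneg_right h1 hp0
    rw [hM, hL]; linarith
  have hM0 : 0 < M := by linarith
  have hsub : {G : SimpleGraph V |
      ¬ ((1 - (δ + 2 * S.card / m)) * (S.card * (p : ℝ)) ≤ groundedEigenvalue G S ∧
        groundedEigenvalue G S ≤ (1 + (δ + 2 * S.card / m)) * (S.card * (p : ℝ)))} ⊆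
      ({G | edgeCount G S Sᶜ < (1 - δ) * M ∨ (1 + δ) * M < edgeCount G S Sᶜ} ∪
        {G | ∃ u ∉ S, 4 * L < edgeCount G {u} (Sᶜ \ {u})}) ∪
      {G | ∃ A ⊆ Sᶜ, A.Nonempty ∧ 2 * A.card ≤ Sᶜ.card ∧
        edgeCount G A (Sᶜ \ A) < c * L * A.card} := by
    intro G hG
    by_contra hcon
    refine hG ?_
    simp only [Set.mem_union, Set.mem_ofPred_eq, not_or, not_exists, not_and, not_lt] at hcon
    obtain ⟨⟨⟨hlo, hhi⟩, hdeg⟩, hexp⟩ := hcon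
    have hkp : 0 ≤ (S.card : ℝ) * p := by positivity
    have hkm : 0 ≤ 2 * (S.card : ℝ) / m := by positivity
    have hkm1 : 2 * (S.card : ℝ) / m ≤ 1 := by rw [div_le_one hm0]; exact hSm
    constructor
    · refine le_groundedEigenvalue_of_expansion G S hSne (c * L) (4 * L) m _ (by positivity)
        (by positivity) ?_ hdeg (fun A h1 h2 h3 => hexp A h1 h2 h3) ?_ ?_
      · rw [hm]; field_simp; norm_num
      -- The candidate bound stays below m/2 because kp ≤ k ≤ m/2.
      · have h1 : (S.card : ℝ) * p ≤ S.card := mul_le_of_le_one_right (by positivity) hp1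
        nlinarith
      · have h1 := mul_le_mul_of_nonneg_right hlo (sub_nonneg.2 hkm1)
        -- This is the product term in (1 − δ)(1 − 2k/m) ≥ 1 − (δ + 2k/m).
        have h2 : 0 ≤ δ * (2 * S.card / m) * M := by positivity
        have h3 : (1 - (δ + 2 * S.card / m)) * (S.card * (p : ℝ)) * Sᶜ.card =
            (1 - (δ + 2 * S.card / m)) * M := by rw [hM]; ring
        rw [h3]
        nlinarith
    · have h1 := (groundedEigenvalue_mul_card_le G S hSne).trans hhi
      have h2 : (1 + δ) * M = (1 + δ) * (S.card * p) * Sᶜ.card := by rw [hM]; ring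
      rw [h2] at h1
      have h3 := le_of_mul_le_mul_right h1 hN0
      nlinarith
  refine (measureReal_mono hsub).trans ((measureReal_union_le _ _).trans
    (add_le_add ((measureReal_union_le _ _).trans (add_le_add ?_ ?_)) ?_))
  · refine (binomialRandom_real_boundary_le p S δ M hδ0 hδ1 hM).trans ?_
    have : L * δ ^ 2 / 8 ≤ M * δ ^ 2 / 4 := by nlinarith [sq_nonneg δ]
    gcongr
  · exact binomialRandom_real_lt_degree_le p S L hL
  · exact binomialRandom_real_not_expansion_le p S τ t c L hτ0 hτ1 ht hc hL hcardpos hS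

end Concentration

/-! ### Random grounded set and limits of the error terms. -/

section Asymptotics

instance {V : Type*} [Countable V] : MeasurableSingletonClass (Finset V) where
  measurableSet_singleton S := by
    refine (measurableSet_finset_iff _).2 ⟨{(S : Set V)}, measurableSet_singleton _, ?_⟩
    ext T
    simp

theorem isProbabilityMeasure_uniformOn_card_eq (n k : ℕ) (hk : k ≤ n) :
    IsProbabilityMeasure (uniformOn {S : Finset (Fin n) | S.card = k}) := by
  refine isProbabilityMeasure_uniformOn (Set.toFinite _) ?_
  obtain ⟨S, -, hS⟩ := Finset.exists_subset_card_eq (s := (Finset.univ : Finset (Fin n))) (n := k)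
    (by simpa using hk)
  exact ⟨S, hS⟩

/-- A bound that holds for each fixed grounded set holds for the random one. -/
theorem one_sub_le_groundedErdosRenyi (n k : ℕ) (p : unitInterval) (hk : k ≤ n)
    (good : Set (SimpleGraph (Fin n) × Finset (Fin n))) (ε : ℝ)
    (h : ∀ S : Finset (Fin n), S.card = k →
      (SimpleGraph.binomialRandom (Fin n) p).real {G | ¬ (G, S) ∈ good} ≤ ε) :
    1 - ENNReal.ofReal ε ≤ groundedErdosRenyi n p k good := by
  have := isProbabilityMeasure_uniformOn_card_eq n k hk
  have hprob : IsProbabilityMeasure (groundedErdosRenyi n p k) := by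
    unfold groundedErdosRenyi; infer_instance
  have hbad : groundedErdosRenyi n p k goodᶜ ≤ ENNReal.ofReal ε := by
    rw [groundedErdosRenyi, Measure.prod_apply_symm (Set.toFinite _).measurableSet]
    have hae : ∀ᵐ S ∂(uniformOn {S : Finset (Fin n) | S.card = k}),
        SimpleGraph.binomialRandom (Fin n) p ((fun G => (G, S)) ⁻¹' goodᶜ) ≤ ENNReal.ofReal ε := by
      filter_upwards [ae_cond_mem (μ := Measure.count)
        (Set.toFinite {S : Finset (Fin n) | S.card = k}).measurableSet] with S hS
      rw [← ofReal_measureReal]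
      exact ENNReal.ofReal_le_ofReal (h S hS)
    refine (lintegral_mono_ae hae).trans ?_
    simp
  have hcompl := prob_compl_eq_one_sub (μ := groundedErdosRenyi n p k)
    (Set.toFinite goodᶜ).measurableSet
  rw [compl_compl] at hcompl
  rw [hcompl]
  exact tsub_le_tsub_left hbad 1

theorem exists_log_le_of_limsup_lt_one (L : ℕ → ℝ)
    (h : limsup (fun n : ℕ => ENNReal.ofReal (Real.log n) / ENNReal.ofReal (L n)) atTop < 1) :
    ∃ τ : ℝ, 0 < τ ∧ τ ≤ 1 ∧ ∀ᶠ n : ℕ in atTop, 0 < L n ∧ Real.log n ≤ (1 - τ) * L n := by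
  obtain ⟨b, hb1, hb2⟩ := exists_between h
  have hbtop : b ≠ ⊤ := (hb2.trans ENNReal.one_lt_top).ne
  have hb : b.toReal < 1 := by
    rw [← ENNReal.toReal_one]
    exact (ENNReal.toReal_lt_toReal hbtop ENNReal.one_ne_top).2 hb2
  refine ⟨1 - b.toReal, by linarith, by linarith [ENNReal.toReal_nonneg (a := b)], ?_⟩
  filter_upwards [eventually_lt_of_limsup_lt hb1, eventually_ge_atTop 2] with n hn hn2
  have hlog : 0 < Real.log n := Real.log_pos (by exact_mod_cast hn2)
  have hL : 0 < L n := by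
    by_contra hL
    -- A positive logarithm over zero is `⊤`; this is why n ≥ 2 is required above.
    rw [ENNReal.ofReal_of_nonpos (not_lt.1 hL), ENNReal.div_zero
      (ENNReal.ofReal_pos.2 hlog).ne'] at hn
    exact not_top_lt hn
  refine ⟨hL, ?_⟩
  rw [ENNReal.div_lt_iff (Or.inl (ENNReal.ofReal_pos.2 hL).ne') (Or.inl ENNReal.ofReal_ne_top),
    ← ENNReal.ofReal_toReal hbtop, ← ENNReal.ofReal_mul ENNReal.toReal_nonneg] at hn
  rw [sub_sub_cancel]
  exact ((ENNReal.ofReal_lt_ofReal_iff_of_nonneg hlog.le).1 hn).le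

/-- The explicit failure probability is bounded by a function of `L = n p` alone. -/
theorem failure_bound_le (n : ℕ) (hn : 1 ≤ n) (τ L : ℝ) (hτ0 : 0 < τ) (hL : 0 < L)
    (hlog : Real.log n ≤ (1 - τ) * L) (hr : 2 * Real.exp (-(τ * L / 32)) ≤ 1) :
    2 * Real.exp (-(L * (√(√L))⁻¹ ^ 2 / 8)) + n * Real.exp (-(2 * L)) +
      ((1 + Real.exp (-(1 - τ / 2) * L)) ^ n - 1 + (2 * Real.exp (-(τ * L / 32))) ^ n) ≤
    2 * Real.exp (-(√L / 8)) + Real.exp (-L) +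
      (Real.exp (Real.exp (-(τ * L / 2))) - 1 + 2 * Real.exp (-(τ * L / 32))) := by
  have hn0 : (0 : ℝ) < n := by exact_mod_cast hn
  have hτL : 0 < τ * L := by positivity
  have h1 : L * (√(√L))⁻¹ ^ 2 = √L := by
    rw [inv_pow, Real.sq_sqrt (Real.sqrt_nonneg _), ← div_eq_mul_inv, Real.div_sqrt]
  have h2 : n * Real.exp (-(2 * L)) ≤ Real.exp (-L) := by
    rw [← Real.exp_log hn0, ← Real.exp_add, Real.exp_le_exp]
    linarith
  -- The margin: n ≤ exp((1 − τ)L) against the rate 1 − τ/2 leaves τ/2.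
  have h3 : n * Real.exp (-(1 - τ / 2) * L) ≤ Real.exp (-(τ * L / 2)) := by
    rw [← Real.exp_log hn0, ← Real.exp_add, Real.exp_le_exp]
    linarith
  have h4 : (1 + Real.exp (-(1 - τ / 2) * L)) ^ n ≤ Real.exp (Real.exp (-(τ * L / 2))) := by
    calc _ ≤ Real.exp (Real.exp (-(1 - τ / 2) * L)) ^ n := by
          gcongr
          linarith [Real.add_one_le_exp (Real.exp (-(1 - τ / 2) * L))]
      _ = Real.exp (n * Real.exp (-(1 - τ / 2) * L)) := (Real.exp_nat_mul _ _).symm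
      _ ≤ _ := Real.exp_le_exp.2 h3
  have h5 : (2 * Real.exp (-(τ * L / 32))) ^ n ≤ 2 * Real.exp (-(τ * L / 32)) :=
    pow_le_of_le_one (by positivity) hr (by omega)
  rw [h1]
  linarith

theorem tendsto_failure_bound (τ : ℝ) (hτ : 0 < τ) :
    Tendsto (fun L : ℝ => 2 * Real.exp (-(√L / 8)) + Real.exp (-L) +
      (Real.exp (Real.exp (-(τ * L / 2))) - 1 + 2 * Real.exp (-(τ * L / 32)))) atTop (𝓝 0) := by
  have key : ∀ g : ℝ → ℝ, Tendsto g atTop atTop →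
      Tendsto (fun L => Real.exp (-(g L))) atTop (𝓝 0) := fun g hg =>
    Real.tendsto_exp_neg_atTop_nhds_zero.comp hg
  have h1 := key (fun L => √L / 8) (Real.tendsto_sqrt_atTop.atTop_div_const (by norm_num))
  have h2 := key (fun L => L) tendsto_id
  have hτL : Tendsto (fun L : ℝ => τ * L) atTop atTop := tendsto_id.const_mul_atTop hτ
  have h3 := key (fun L => τ * L / 2) (hτL.atTop_div_const (by norm_num))
  have h4 := key (fun L => τ * L / 32) (hτL.atTop_div_const (by norm_num))
  have h5 := (Real.continuous_exp.tendsto 0).comp h3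
  rw [Real.exp_zero] at h5
  have := ((h1.const_mul 2).add h2).add ((h5.sub_const 1).add (h4.const_mul 2))
  simpa using this

end Asymptotics

end

/-! ### Choice of the error function and conclusion. -/

theorem theorem3 (p : ℕ → unitInterval) (k : ℕ → ℕ)
    -- the quotient is taken in `[0, ∞]`, where `ln n / (n p) = ∞` for `p = 0` and `n ≥ 2`
    (hp : limsup (fun n : ℕ =>
      ENNReal.ofReal (Real.log n) / ENNReal.ofReal ((n : ℝ) * (p n : ℝ))) atTop < 1)
    (hk_pos : ∀ᶠ n in atTop, 1 ≤ k n)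
    (hk : (fun n : ℕ => (k n : ℝ)) =o[atTop] fun n : ℕ => Real.sqrt ((n : ℝ) * (p n : ℝ))) :
    ∃ h : ℕ → ℝ, Tendsto h atTop (𝓝 0) ∧
      Tendsto (fun n : ℕ => groundedErdosRenyi n (p n) (k n)
        {x : SimpleGraph (Fin n) × Finset (Fin n) |
          (1 - h n) * ((k n : ℝ) * (p n : ℝ)) ≤ groundedEigenvalue x.1 x.2 ∧
          groundedEigenvalue x.1 x.2 ≤ (1 + h n) * ((k n : ℝ) * (p n : ℝ))})
        atTop (𝓝 1) := by
  set L : ℕ → ℝ := fun n => (n : ℝ) * (p n : ℝ) with hL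
  obtain ⟨τ, hτ0, hτ1, hlog⟩ := exists_log_le_of_limsup_lt_one L hp
  set t := Real.log (8 / τ) with ht
  set c := τ / (16 * t) with hc
  have ht0 : 0 < t := Real.log_pos (by rw [lt_div_iff₀ hτ0]; linarith)
  have hc0 : 0 < c := by positivity
  have hLtop : Tendsto L atTop atTop := by
    refine tendsto_atTop_mono' _ ?_ (Real.tendsto_log_atTop.comp tendsto_natCast_atTop_atTop)
    filter_upwards [hlog] with n hn
    have : (1 - τ) * L n ≤ 1 * L n := mul_le_mul_of_nonneg_right (by linarith) hn.1.le
    exact hn.2.trans (by linarith)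
  have hsqrt : Tendsto (fun n => √(L n)) atTop atTop := Real.tendsto_sqrt_atTop.comp hLtop
  have hδ : Tendsto (fun n => (√(√(L n)))⁻¹) atTop (𝓝 0) :=
    tendsto_inv_atTop_zero.comp (Real.tendsto_sqrt_atTop.comp hsqrt)
  have hkL : Tendsto (fun n => (k n : ℝ) / L n) atTop (𝓝 0) := by
    have h1 := hk.tendsto_div_nhds_zero.mul (tendsto_inv_atTop_zero.comp hsqrt)
    rw [zero_mul] at h1
    refine h1.congr' ?_
    filter_upwards [hlog] with n hn
    show (k n : ℝ) / √(L n) * (√(L n))⁻¹ = k n / L n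
    rw [← div_eq_mul_inv, div_div, Real.mul_self_sqrt hn.1.le]
  -- δ = L^(−1/4) tends to zero while Lδ² = √L still diverges in the Chernoff exponent; the second
  -- summand is 2k/m.
  set h : ℕ → ℝ := fun n => (√(√(L n)))⁻¹ + 2 * k n / (c ^ 2 * L n / 32) with hh
  have hh0 : Tendsto h atTop (𝓝 0) := by
    have h1 := hδ.add (hkL.const_mul (64 / c ^ 2))
    rw [mul_zero, add_zero] at h1
    refine h1.congr' ?_
    filter_upwards [hlog] with n hn
    have := hn.1.ne'
    simp only [hh]
    field_simp
    ring
  refine ⟨h, hh0, ?_⟩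
  have hfail := (tendsto_failure_bound τ hτ0).comp hLtop
  have hlow : Tendsto (fun n => 1 - ENNReal.ofReal (2 * Real.exp (-(√(L n) / 8)) +
      Real.exp (-(L n)) + (Real.exp (Real.exp (-(τ * L n / 2))) - 1 +
        2 * Real.exp (-(τ * L n / 32))))) atTop (𝓝 1) := by
    have h1 := ENNReal.tendsto_ofReal hfail
    rw [ENNReal.ofReal_zero] at h1
    have h2 := ENNReal.Tendsto.sub (tendsto_const_nhds (x := (1 : ENNReal))) h1
      (Or.inl ENNReal.one_ne_top)
    rwa [tsub_zero] at h2
  have hr : ∀ᶠ n in atTop, 2 * Real.exp (-(τ * L n / 32)) ≤ 1 := by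
    have h1 : Tendsto (fun n => τ * L n / 32) atTop atTop :=
      (hLtop.const_mul_atTop hτ0).atTop_div_const (by norm_num)
    have h2 := (Real.tendsto_exp_neg_atTop_nhds_zero.comp h1).const_mul 2
    rw [mul_zero] at h2
    exact (h2.eventually (eventually_le_nhds zero_lt_one))
  have hle : ∀ᶠ n in atTop, 1 - ENNReal.ofReal (2 * Real.exp (-(√(L n) / 8)) +
      Real.exp (-(L n)) + (Real.exp (Real.exp (-(τ * L n / 2))) - 1 +
        2 * Real.exp (-(τ * L n / 32)))) ≤ groundedErdosRenyi n (p n) (k n)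
        {x : SimpleGraph (Fin n) × Finset (Fin n) |
          (1 - h n) * ((k n : ℝ) * (p n : ℝ)) ≤ groundedEigenvalue x.1 x.2 ∧
          groundedEigenvalue x.1 x.2 ≤ (1 + h n) * ((k n : ℝ) * (p n : ℝ))} := by
    have hτ16 : 0 < τ / 16 := by positivity
    have hcc : 0 < c ^ 2 / 64 := by positivity
    -- The two thresholds on k/L give k ≤ τn/16 (as L ≤ n) and 2k ≤ m.
    filter_upwards [hlog, hk_pos, hr, eventually_ge_atTop 1,
      hkL.eventually (eventually_le_nhds hτ16), hkL.eventually (eventually_le_nhds hcc),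
      hδ.eventually (eventually_le_nhds zero_lt_one)] with n hn hk1 hrn hn1 hkτ hkc hδ1
    rw [div_le_iff₀ hn.1] at hkτ hkc
    have hLn : L n ≤ n := mul_le_of_le_one_right (by positivity) (p n).2.2
    have hkn : (k n : ℝ) ≤ τ / 16 * n :=
      hkτ.trans (mul_le_mul_of_nonneg_left hLn hτ16.le)
    have hkn' : k n ≤ n := by
      have : (k n : ℝ) ≤ n := by
        have : τ / 16 * n ≤ 1 * n := mul_le_mul_of_nonneg_right (by linarith) (by positivity)
        linarith
      exact_mod_cast this
    refine one_sub_le_groundedErdosRenyi n (k n) (p n) hkn' _ _ fun S hS => ?_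
    have hsq : 0 < √(√(L n)) := Real.sqrt_pos.2 (Real.sqrt_pos.2 hn.1)
    have hmain := binomialRandom_real_groundedEigenvalue_le (p n) S τ t c (L n)
      (c ^ 2 * L n / 32) (√(√(L n)))⁻¹ hτ0 hτ1 ht hc (by simp [hL]) hn.1 rfl
      (by simpa [hS] using hkn) (by rw [hS]; exact hk1) (by rw [hS]; linarith)
      (inv_pos.2 hsq) hδ1
    rw [Fintype.card_fin, hS] at hmain
    exact hmain.trans (failure_bound_le n hn1 τ (L n) hτ0 hn.1 hn.2 hrn)
  refine tendsto_of_tendsto_of_tendsto_of_le_of_le' hlow tendsto_const_nhds hle ?_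
  filter_upwards [hlog, hkL.eventually (eventually_le_nhds zero_lt_one)] with n hn hkL1
  have hkn : (k n : ℝ) ≤ n := by
    rw [div_le_one hn.1] at hkL1
    exact hkL1.trans (mul_le_of_le_one_right (by positivity) (p n).2.2)
  have := isProbabilityMeasure_uniformOn_card_eq n (k n) (by exact_mod_cast hkn)
  have : IsProbabilityMeasure (groundedErdosRenyi n (p n) (k n)) := by
    unfold groundedErdosRenyi; infer_instance
  exact prob_le_one
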